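/- Let $\mathrm{MAJ}_n\colon\{0,1\}^n\to\{0,1\}$ be the majority function, $\mathrm{MAJ}_n(x)=1$ if and only if $\sum_{i=1}^n x_i\ge n/2$. A $\mathrm{MAJ}_k\circ\mathrm{MAJ}_k$ circuit on $x_1,\dots,x_n$ is a depth-two circuit in which finitely many bottom gates read input variables and a single top gate reads the outputs of the bottom gates; every gate is a threshold function $[\sum_i c_i z_i\ge t]$ of its inputs $z_i$, with positive integer weights $c_i$ satisfying $\sum_i c_i\le k$ and an arbitrary integer threshold $t$. Theorem. There is an absolute constant $c>0$ such that for all integers $n\ge 2$, $k\ge 0$ and $W\ge 1$ the following holds. If a $\mathrm{MAJ}_k\circ\mathrm{MAJ}_k$ circuit computes $\mathrm{MAJ}_n$ on all inputs $x\in\{0,1\}^n$, and the weight of every variable $x_i$ in every bottom gate is at most $W$ (no bound beyond $k$ is imposed on the weights of the top gate), then $$k\;\ge\; c\cdot n^{7/10}\,(\log n)^{-1/5}\,W^{-3/10}.$$ -/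

import Mathlib

/-- A monotone threshold gate `[∑ cᵢ xᵢ ≥ t]` whose inputs are taken among the family indexed
by `ι`: `weight i` is the coefficient of `i`, and `weight i = 0` means that `i` is not an input
of the gate. -/
structure ThresholdGate (ι : Type) where
  weight : ι → ℕ
  threshold : ℤ

namespace ThresholdGate

variable {ι : Type} [Fintype ι]

/-- The sum of the coefficients of the gate (its fan-in, counted with multiplicity). -/
def totalWeight (G : ThresholdGate ι) : ℕ := ∑ i, G.weight i

/-- The Boolean value of the gate on an assignment. -/
def eval (G : ThresholdGate ι) (x : ι → Bool) : Bool :=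
  decide (G.threshold ≤ ∑ i, (G.weight i : ℤ) * (if x i then 1 else 0))

end ThresholdGate

/-- A depth-two circuit of monotone threshold gates on `n` input bits: bottom gates read the
input bits, and the top gate reads the outputs of all the bottom gates, with positive
coefficients. -/
structure DepthTwoCircuit (n : ℕ) where
  numGates : ℕ
  bottom : Fin numGates → ThresholdGate (Fin n)
  top : ThresholdGate (Fin numGates)
  top_pos : ∀ j, 0 < top.weight j

namespace DepthTwoCircuit

variable {n : ℕ}

/-- The Boolean value of the circuit on an input. -/
def eval (C : DepthTwoCircuit n) (x : Fin n → Bool) : Bool :=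
  C.top.eval fun j => (C.bottom j).eval x

/-- `C` is a `MAJ_k ∘ MAJ_k` circuit: in every gate the coefficients sum to at most `k`. -/
def IsMajMaj (C : DepthTwoCircuit n) (k : ℕ) : Prop :=
  C.top.totalWeight ≤ k ∧ ∀ j, (C.bottom j).totalWeight ≤ k

/-- Every input variable has weight at most `W` in every gate that reads variables. -/
def VarWeightsLE (C : DepthTwoCircuit n) (W : ℕ) : Prop :=
  ∀ j i, (C.bottom j).weight i ≤ W

end DepthTwoCircuit

/-- The standard majority function `MAJ_n(x) = [∑ xᵢ ≥ n / 2]`. -/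
def majority (n : ℕ) (x : Fin n → Bool) : Bool :=
  decide ((n : ℚ) / 2 ≤ ∑ i, (if x i then 1 else 0))

/-!
The proof gives the stronger bound `k ≥ c n ^ (3/4) / (log n) ^ (1/4)`, without any dependence on
the weights.

Let `m = ⌈n / 2⌉`. If a circuit computes majority, then at every point `x` of the layer `|x| = m`
and for every `i` with `x i = 1`, some bottom gate changes its value when the bit `i` is negated
(`exists_gate_pivotal`). Every point of the layer thus has at least `m` pairs of a gate and a bit
pivotal for it, and the point is to find a distribution on the cube which charges the layer and for
which the gates have small total influence.

Each gate `j` receives an independent signal `ε j`, uniform on `[-1/2, 1/2]`. The bits are then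
independent, the bit `i` being `1` with probability `1 / 2 + bias a ε i`, where the bias is a linear
combination of the signals of the gates that read `i`, centred (`signalStrength`) so that the mean
number of ones stays `n / 2`. A typical variable is read by at most `D = O(k² / n)` gates, so by
Hoeffding's inequality signals of strength `u` of order `1 / √(D log n)` keep all biases bounded by
`1 / 4` with probability at least `1 / 2` (`le_measureReal_goodSignals`). By the Margulis–Russo
formula the derivative of the mean of the gate `j` in its own signal is at least `u / 2` times its
total influence on the biased bits. That mean stays in `[0, 1]`, so the total influence integrates
to at most `2 / u` over the signal `j`, and to at most `2 k / u` when summed over the gates; hence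
some good choice of signals has total influence `O(k / u)`
(`exists_goodSignals_sum_influence_le`).

Only a small constant fraction `H` of the bits is biased; the others are fair coins. They make the
passage to the layer harmless: the layer has probability of order at least `1 / √n`, also jointly
with `x i = 1` (`le_sum_layer`), while conditioned on the inputs of a single gate it has probability
at most of order `1 / √n` (`sum_layer_le`). Comparing the two estimates gives
`n = O(k / u) = O(k² √(log n / n))`.
-/

open Finset

/-! ### Product Bernoulli measures and the Margulis–Russo formula -/

/-- The weight of the point `x` of the cube under the product of the Bernoulli measures with
parameters `p i`. -/
noncomputable def bernWeight {ι : Type*} [Fintype ι] (p : ι → ℝ) (x : ι → Bool) : ℝ :=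
  ∏ i, if x i then p i else 1 - p i

/-- The point `x` with its `i`-th bit negated. -/
def flipBit {ι : Type*} [DecidableEq ι] (i : ι) (x : ι → Bool) : ι → Bool :=
  Function.update x i (!x i)

/-- The influence of the `i`-th bit on `g` under the product Bernoulli measure: the mean of
`|g x - g (flipBit i x)|`. -/
noncomputable def influence {ι : Type*} [Fintype ι] [DecidableEq ι] (p : ι → ℝ)
    (g : (ι → Bool) → ℝ) (i : ι) : ℝ :=
  ∑ x, bernWeight p x * |g x - g (flipBit i x)|

section Bernoulli

variable {ι : Type*} [Fintype ι] [DecidableEq ι]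

omit [DecidableEq ι] in
lemma bernWeight_nonneg {p : ι → ℝ} (hp : ∀ i, 0 ≤ p i ∧ p i ≤ 1) (x : ι → Bool) :
    0 ≤ bernWeight p x := by
  refine Finset.prod_nonneg fun i _ => ?_
  have := hp i
  split_ifs <;> linarith

lemma sum_bernWeight_mul_prod (p : ι → ℝ) (f : ι → Bool → ℝ) :
    ∑ x, bernWeight p x * ∏ i, f i (x i) = ∏ i, (p i * f i true + (1 - p i) * f i false) := by
  have h := Finset.prod_univ_sum (fun _ : ι => (Finset.univ : Finset Bool))
    (fun i b => (if b then p i else 1 - p i) * f i b)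
  simp only [Fintype.sum_bool, Fintype.piFinset_univ, if_true, Bool.false_eq_true, if_false] at h
  rw [h]
  exact Finset.sum_congr rfl fun x _ => by rw [bernWeight, ← Finset.prod_mul_distrib]

lemma sum_bernWeight (p : ι → ℝ) : ∑ x, bernWeight p x = 1 := by
  have h := sum_bernWeight_mul_prod p (fun _ _ => 1)
  simpa using h

lemma sum_bernWeight_mul_coord (p : ι → ℝ) (i : ι) (φ : Bool → ℝ) :
    ∑ x, bernWeight p x * φ (x i) = p i * φ true + (1 - p i) * φ false := by
  have h := sum_bernWeight_mul_prod p (fun l b => if l = i then φ b else 1)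
  simp only [Finset.prod_ite_eq', Finset.mem_univ, if_true] at h
  rw [h, ← Finset.mul_prod_erase _ _ (Finset.mem_univ i)]
  rw [Finset.prod_eq_one (fun l hl => by simp [Finset.ne_of_mem_erase hl])]
  simp

lemma sum_bernWeight_cov (p : ι → ℝ) {i l : ι} (hil : i ≠ l) :
    ∑ x, bernWeight p x *
      (((if x i then (1 : ℝ) else 0) - p i) * ((if x l then (1 : ℝ) else 0) - p l)) = 0 := by
  have h := sum_bernWeight_mul_prod p (fun k b =>
    (if k = i then ((if b then (1 : ℝ) else 0) - p i) else 1) *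
    (if k = l then ((if b then (1 : ℝ) else 0) - p l) else 1))
  simp only [Finset.prod_mul_distrib, Finset.prod_ite_eq', Finset.mem_univ, if_true] at h
  rw [h]
  refine Finset.prod_eq_zero (Finset.mem_univ i) ?_
  simp [hil]
  ring

lemma sum_bernWeight_variance (p : ι → ℝ) (H : Finset ι) :
    ∑ x, bernWeight p x * (∑ i ∈ H, ((if x i then (1 : ℝ) else 0) - p i)) ^ 2 =
      ∑ i ∈ H, p i * (1 - p i) := by
  have h : ∀ x, bernWeight p x * (∑ i ∈ H, ((if x i then (1 : ℝ) else 0) - p i)) ^ 2 =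
      ∑ i ∈ H, ∑ l ∈ H, bernWeight p x *
      (((if x i then (1 : ℝ) else 0) - p i) * ((if x l then (1 : ℝ) else 0) - p l)) := by
    intro x
    rw [sq, Finset.sum_mul_sum]
    simp only [Finset.mul_sum]
  rw [Finset.sum_congr rfl (fun x _ => h x), Finset.sum_comm]
  refine Finset.sum_congr rfl fun i hi => ?_
  rw [Finset.sum_comm, Finset.sum_eq_single_of_mem i hi
    (fun l _ hl => sum_bernWeight_cov p hl.symm)]
  rw [sum_bernWeight_mul_coord p i
    (fun b => ((if b then (1 : ℝ) else 0) - p i) * ((if b then (1 : ℝ) else 0) - p i))]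
  simp
  ring

omit [Fintype ι] in
lemma flipBit_flipBit (i : ι) (x : ι → Bool) : flipBit i (flipBit i x) = x := by
  funext l
  by_cases h : l = i
  · subst h; simp [flipBit]
  · simp [flipBit, h]

omit [Fintype ι] in
lemma flipBit_apply_self (i : ι) (x : ι → Bool) : flipBit i x i = !x i := by simp [flipBit]

omit [Fintype ι] in
lemma flipBit_apply_of_ne {i l : ι} (h : l ≠ i) (x : ι → Bool) : flipBit i x l = x l := by
  simp [flipBit, h]

lemma sum_flipBit (i : ι) (f : (ι → Bool) → ℝ) : ∑ x, f (flipBit i x) = ∑ x, f x :=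
  Fintype.sum_equiv ⟨flipBit i, flipBit i, flipBit_flipBit i, flipBit_flipBit i⟩ _ _
    (fun _ => rfl)

/-- For monotone `g` the partial derivative of the mean of `g` in the parameter `p i` is the
influence of the bit `i`. -/
lemma sum_signed_eq_influence (p : ι → ℝ) {g : (ι → Bool) → ℝ} (hg : Monotone g) (i : ι) :
    ∑ x, g x * ((∏ l ∈ univ.erase i, if x l then p l else 1 - p l) *
      (if x i then 1 else -1)) = influence p g i := by
  unfold influence
  -- averaging both sides over the negation of the bit `i` makes them equal term by term
  have key : ∀ x, g x * ((∏ l ∈ univ.erase i, if x l then p l else 1 - p l) *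
      (if x i then 1 else -1)) + g (flipBit i x) *
      ((∏ l ∈ univ.erase i, if flipBit i x l then p l else 1 - p l) *
      (if flipBit i x i then 1 else -1)) =
      bernWeight p x * |g x - g (flipBit i x)| + bernWeight p (flipBit i x) *
        |g (flipBit i x) - g (flipBit i (flipBit i x))| := by
    intro x
    have hP : (∏ l ∈ univ.erase i, if flipBit i x l then p l else 1 - p l) =
        ∏ l ∈ univ.erase i, if x l then p l else 1 - p l :=
      Finset.prod_congr rfl fun l hl => by rw [flipBit_apply_of_ne (Finset.ne_of_mem_erase hl)]
    have hw : ∀ y : ι → Bool, bernWeight p y = (if y i then p i else 1 - p i) *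
        ∏ l ∈ univ.erase i, if y l then p l else 1 - p l := fun y =>
      (Finset.mul_prod_erase _ _ (Finset.mem_univ i)).symm
    rw [hw x, hw (flipBit i x), hP, flipBit_flipBit, flipBit_apply_self,
      abs_sub_comm (g (flipBit i x))]
    cases hx : x i
    · have hle : x ≤ flipBit i x := by
        intro l
        by_cases h : l = i
        · subst h; simp [flipBit, hx]
        · simp [flipBit, h]
      rw [abs_of_nonpos (sub_nonpos.2 (hg hle))]
      simp; ring
    · have hle : flipBit i x ≤ x := by
        intro l
        by_cases h : l = i
        · subst h; simp [flipBit, hx]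
        · simp [flipBit, h]
      rw [abs_of_nonneg (sub_nonneg.2 (hg hle))]
      simp; ring
  have h2 := Finset.sum_congr (rfl : (univ : Finset (ι → Bool)) = univ) (fun x _ => key x)
  rw [Finset.sum_add_distrib, Finset.sum_add_distrib] at h2
  have e1 := sum_flipBit i (fun x => g x *
    ((∏ l ∈ univ.erase i, if x l then p l else 1 - p l) * (if x i then 1 else -1)))
  have e2 := sum_flipBit i (fun x => bernWeight p x * |g x - g (flipBit i x)|)
  linarith

/-- The Margulis–Russo formula along a line `s ↦ α + s β` of parameters. -/
lemma hasDerivAt_sum_bernWeight (α β : ι → ℝ) {g : (ι → Bool) → ℝ} (hg : Monotone g) (s : ℝ) :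
    HasDerivAt (fun s => ∑ x, bernWeight (fun i => α i + s * β i) x * g x)
      (∑ i, β i * influence (fun i => α i + s * β i) g i) s := by
  have hfac : ∀ (x : ι → Bool) (i : ι), HasDerivAt
      (fun s => if x i then α i + s * β i else 1 - (α i + s * β i))
      (if x i then β i else -β i) s := by
    intro x i
    have h1 : HasDerivAt (fun s : ℝ => α i + s * β i) (β i) s := by
      simpa using ((hasDerivAt_id s).mul_const (β i)).const_add (α i)
    cases x i
    · simpa using h1.const_sub 1
    · simpa using h1
  have hprod : ∀ x : ι → Bool, HasDerivAt
      (fun s => bernWeight (fun i => α i + s * β i) x)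
      (∑ i, (∏ l ∈ univ.erase i, if x l then α l + s * β l else 1 - (α l + s * β l)) •
        (if x i then β i else -β i)) s := by
    intro x
    exact HasDerivAt.fun_finsetProd (fun i _ => hfac x i)
  have hsum := HasDerivAt.fun_sum (u := (univ : Finset (ι → Bool)))
    (fun x _ => (hprod x).mul_const (g x))
  refine hsum.congr_deriv ?_
  simp only [Finset.sum_mul]
  rw [Finset.sum_comm]
  refine Finset.sum_congr rfl fun i _ => ?_
  rw [← sum_signed_eq_influence _ hg i, Finset.mul_sum]
  refine Finset.sum_congr rfl fun x _ => ?_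
  cases x i <;> simp <;> ring

lemma influence_nonneg {p : ι → ℝ} (hp : ∀ i, 0 ≤ p i ∧ p i ≤ 1) (g : (ι → Bool) → ℝ) (i : ι) :
    0 ≤ influence p g i :=
  Finset.sum_nonneg fun x _ => mul_nonneg (bernWeight_nonneg hp x) (abs_nonneg _)

lemma influence_eq_zero (p : ι → ℝ) {g : (ι → Bool) → ℝ} {i : ι}
    (h : ∀ x, g (flipBit i x) = g x) : influence p g i = 0 := by
  simp [influence, h]

lemma continuous_influence (g : (ι → Bool) → ℝ) (i : ι) :
    Continuous fun p : ι → ℝ => influence p g i := by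
  unfold influence bernWeight
  refine continuous_finsetSum _ fun x _ => Continuous.mul
    (continuous_finsetProd _ fun l _ => ?_) continuous_const
  cases x l <;> simp <;> fun_prop

/-- Integrated Margulis–Russo formula: along a segment of parameters on which the coordinates
in `T` move with speed at least `b` and the others do not spoil the monotonicity, the influences
of a monotone `[0,1]`-valued function integrate to at most `1 / b`. -/
lemma lintegral_sum_influence_le (α β : ι → ℝ) {g : (ι → Bool) → ℝ} (hg : Monotone g)
    (hg0 : ∀ x, 0 ≤ g x) (hg1 : ∀ x, g x ≤ 1) (T : Finset ι) {b : ℝ} (hb : 0 < b)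
    (hT : ∀ i ∈ T, b ≤ β i) (hβ : ∀ i, 0 ≤ β i ∨ ∀ x, g (flipBit i x) = g x)
    {c d : ℝ} (hcd : c ≤ d) (hp : ∀ s ∈ Set.Icc c d, ∀ i, 0 ≤ α i + s * β i ∧ α i + s * β i ≤ 1) :
    ∫⁻ s in Set.Icc c d, ENNReal.ofReal (∑ i ∈ T, influence (fun i => α i + s * β i) g i) ≤
      ENNReal.ofReal (1 / b) := by
  set φ : ℝ → ℝ := fun s => ∑ x, bernWeight (fun i => α i + s * β i) x * g x with hφ
  have hcont : ∀ i, Continuous fun s : ℝ => influence (fun i => α i + s * β i) g i := fun i =>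
    (continuous_influence g i).comp (by fun_prop)
  have hcontT : Continuous fun s : ℝ => ∑ i ∈ T, influence (fun i => α i + s * β i) g i :=
    continuous_finsetSum _ fun i _ => hcont i
  have hcontD : Continuous fun s : ℝ => ∑ i, β i * influence (fun i => α i + s * β i) g i :=
    continuous_finsetSum _ fun i _ => (hcont i).const_mul _
  have hint : ∫ s in c..d, ∑ i, β i * influence (fun i => α i + s * β i) g i = φ d - φ c :=
    intervalIntegral.integral_eq_sub_of_hasDerivAt
      (fun s _ => hasDerivAt_sum_bernWeight α β hg s) (hcontD.intervalIntegrable _ _)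
  have hφ1 : φ d ≤ 1 := by
    rw [hφ, ← sum_bernWeight (fun i => α i + d * β i)]
    refine Finset.sum_le_sum fun x _ => ?_
    have := bernWeight_nonneg (hp d ⟨hcd, le_rfl⟩) x
    nlinarith [hg1 x]
  have hφ0 : 0 ≤ φ c := Finset.sum_nonneg fun x _ =>
    mul_nonneg (bernWeight_nonneg (hp c ⟨le_rfl, hcd⟩) x) (hg0 x)
  have hle : ∫ s in c..d, b * ∑ i ∈ T, influence (fun i => α i + s * β i) g i ≤
      ∫ s in c..d, ∑ i, β i * influence (fun i => α i + s * β i) g i := by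
    refine intervalIntegral.integral_mono_on hcd ((hcontT.const_mul b).intervalIntegrable _ _)
      (hcontD.intervalIntegrable _ _) fun s hs => ?_
    rw [Finset.mul_sum]
    have hinf := influence_nonneg (hp s hs) g
    calc _ ≤ ∑ i ∈ T, β i * influence (fun i => α i + s * β i) g i :=
          Finset.sum_le_sum fun i hi => mul_le_mul_of_nonneg_right (hT i hi) (hinf i)
      _ ≤ _ := by
          refine Finset.sum_le_sum_of_subset_of_nonneg (Finset.subset_univ _) fun i _ _ => ?_
          rcases hβ i with h | h
          · exact mul_nonneg h (hinf i)
          · rw [influence_eq_zero _ h, mul_zero]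
  rw [intervalIntegral.integral_const_mul, hint] at hle
  rw [← MeasureTheory.ofReal_integral_eq_lintegral_ofReal
    (hcontT.continuousOn.integrableOn_Icc)]
  · refine ENNReal.ofReal_le_ofReal ?_
    rw [MeasureTheory.integral_Icc_eq_integral_Ioc, ← intervalIntegral.integral_of_le hcd,
      le_div_iff₀ hb]
    linarith
  · refine (MeasureTheory.ae_restrict_iff' measurableSet_Icc).2 (Filter.Eventually.of_forall ?_)
    intro s hs
    exact Finset.sum_nonneg fun i _ => influence_nonneg (hp s hs) g i

end Bernoulli

/-! ### Central binomial coefficients -/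

section CentralBinomial

lemma centralBinom_sq_mul_le (r : ℕ) : r.centralBinom ^ 2 * (2 * r + 1) ≤ 16 ^ r := by
  induction r with
  | zero => simp
  | succ r ih =>
    have h := Nat.succ_mul_centralBinom_succ r
    refine Nat.le_of_mul_le_mul_left (c := (r + 1) ^ 2) ?_ (by positivity)
    calc (r + 1) ^ 2 * ((r + 1).centralBinom ^ 2 * (2 * (r + 1) + 1))
        = ((r + 1) * (r + 1).centralBinom) ^ 2 * (2 * r + 3) := by ring
      _ = (4 * (2 * r + 1) * (2 * r + 3)) * (r.centralBinom ^ 2 * (2 * r + 1)) := by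
          rw [h]; ring
      _ ≤ (4 * (2 * r + 1) * (2 * r + 3)) * 16 ^ r := Nat.mul_le_mul_left _ ih
      _ ≤ (16 * (r + 1) ^ 2) * 16 ^ r := Nat.mul_le_mul_right _ (by nlinarith)
      _ = (r + 1) ^ 2 * 16 ^ (r + 1) := by ring

lemma le_centralBinom_sq_mul {r : ℕ} (hr : 1 ≤ r) : 16 ^ r ≤ r.centralBinom ^ 2 * (4 * r) := by
  induction r, hr using Nat.le_induction with
  | base => simp [Nat.centralBinom, Nat.choose]
  | succ r hr ih =>
    have h := Nat.succ_mul_centralBinom_succ r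
    refine Nat.le_of_mul_le_mul_left (c := (r + 1) ^ 2 * r) ?_ (by positivity)
    calc (r + 1) ^ 2 * r * 16 ^ (r + 1) = (16 * r * (r + 1) ^ 2) * 16 ^ r := by ring
      _ ≤ (4 * (2 * r + 1) ^ 2 * (r + 1)) * 16 ^ r := Nat.mul_le_mul_right _ (by nlinarith)
      _ ≤ (4 * (2 * r + 1) ^ 2 * (r + 1)) * (r.centralBinom ^ 2 * (4 * r)) :=
          Nat.mul_le_mul_left _ ih
      _ = (2 * (2 * r + 1) * r.centralBinom) ^ 2 * (4 * (r + 1)) * r := by ring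
      _ = (r + 1) ^ 2 * r * ((r + 1).centralBinom ^ 2 * (4 * (r + 1))) := by rw [← h]; ring

lemma choose_div_four_pow_le (r s : ℕ) :
    ((2 * r).choose s : ℝ) / 4 ^ r ≤ 1 / √(2 * r + 1) := by
  have h1 : ((2 * r).choose s : ℝ) ≤ r.centralBinom := by
    exact_mod_cast Nat.choose_le_centralBinom s r
  have h2 : (r.centralBinom : ℝ) ^ 2 * (2 * r + 1) ≤ 16 ^ r := by
    exact_mod_cast centralBinom_sq_mul_le r
  have hs : (0 : ℝ) < √(2 * r + 1) := Real.sqrt_pos.2 (by positivity)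
  rw [div_le_div_iff₀ (by positivity) hs, one_mul]
  refine (mul_le_mul_of_nonneg_right h1 hs.le).trans ?_
  refine abs_le_of_sq_le_sq' ?_ (by positivity) |>.2
  rw [mul_pow, Real.sq_sqrt (by positivity), ← pow_mul, mul_comm r 2, pow_mul]
  norm_num
  exact h2

lemma le_centralBinom_div_four_pow {r : ℕ} (hr : 1 ≤ r) :
    1 / (2 * √r) ≤ (r.centralBinom : ℝ) / 4 ^ r := by
  have h2 : (16 : ℝ) ^ r ≤ (r.centralBinom : ℝ) ^ 2 * (4 * r) := by
    exact_mod_cast le_centralBinom_sq_mul hr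
  have hr' : (0 : ℝ) < r := by exact_mod_cast hr
  rw [div_le_div_iff₀ (by positivity) (by positivity), one_mul]
  refine abs_le_of_sq_le_sq' ?_ (by positivity) |>.2
  rw [mul_pow, mul_pow, Real.sq_sqrt hr'.le, ← pow_mul, mul_comm r 2, pow_mul]
  norm_num
  exact h2

lemma sub_sq_div_mul_centralBinom_le {r : ℕ} (hr : 1 ≤ r) (s : ℕ) :
    (1 - (s : ℝ) ^ 2 / r) * r.centralBinom ≤ (2 * r).choose (r + s) := by
  have hr' : (1 : ℝ) ≤ r := by exact_mod_cast hr
  induction s with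
  | zero => simp [Nat.centralBinom]
  | succ s ih =>
    have hc : (0 : ℝ) < r.centralBinom := by exact_mod_cast Nat.centralBinom_pos r
    rcases le_or_gt (1 - ((s + 1 : ℕ) : ℝ) ^ 2 / r) 0 with h0 | h0
    · exact (mul_nonpos_of_nonpos_of_nonneg h0 hc.le).trans (Nat.cast_nonneg _)
    have hsq : ((s : ℝ) + 1) ^ 2 < r := by
      have : ((s + 1 : ℕ) : ℝ) ^ 2 / r < 1 := by linarith
      rw [div_lt_one (by linarith)] at this
      exact_mod_cast this
    have hsr : s ≤ r := by
      have : (s : ℝ) ≤ r := by nlinarith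
      exact_mod_cast this
    have h := Nat.choose_succ_right_eq (2 * r) (r + s)
    have h' : ((2 * r).choose (r + s + 1) : ℝ) * (r + s + 1) =
        (2 * r).choose (r + s) * (r - s) := by
      have : 2 * r - (r + s) = r - s := by omega
      rw [this] at h
      have := congrArg (Nat.cast (R := ℝ)) h
      push_cast [Nat.cast_sub hsr] at this
      exact this
    have hs0 : (0 : ℝ) ≤ s := Nat.cast_nonneg s
    have hpos : (0 : ℝ) < r + s + 1 := by positivity
    rw [← add_assoc, ← mul_le_mul_iff_left₀ hpos, h']
    refine le_trans ?_ (mul_le_mul_of_nonneg_right ih (by nlinarith : (0 : ℝ) ≤ r - s))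
    have key : (1 - ((s : ℝ) + 1) ^ 2 / r) * (r + s + 1) ≤ (1 - (s : ℝ) ^ 2 / r) * (r - s) := by
      have e : (1 - (s : ℝ) ^ 2 / r) * (r - s) - (1 - ((s : ℝ) + 1) ^ 2 / r) * (r + s + 1) =
          (s ^ 3 + (s + 1) ^ 3) / r := by
        field_simp
        ring
      have : 0 ≤ ((s : ℝ) ^ 3 + (s + 1) ^ 3) / r := by positivity
      linarith
    push_cast
    nlinarith [mul_le_mul_of_nonneg_right key hc.le]

end CentralBinomial

/-! ### Layers of the cube -/

section Layers

variable {ι : Type*} [Fintype ι] [DecidableEq ι]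

/-- The number of ones of `x` among the coordinates in `S`. -/
def onesIn (S : Finset ι) (x : ι → Bool) : ℕ := #{i ∈ S | x i = true}

/-- The point `x` with the bits in `T` negated. -/
def flipBits (T : Finset ι) (x : ι → Bool) : ι → Bool := fun i => xor (x i) (decide (i ∈ T))

lemma sum_flipBits (T : Finset ι) (f : (ι → Bool) → ℝ) :
    ∑ x, f (flipBits T x) = ∑ x, f x :=
  Fintype.sum_equiv ⟨flipBits T, flipBits T, fun x => by funext i; simp [flipBits],
    fun x => by funext i; simp [flipBits]⟩ _ _ (fun _ => rfl)

lemma bernWeight_flipBits {p : ι → ℝ} {T : Finset ι} (hp : ∀ i ∈ T, p i = 1 / 2)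
    (x : ι → Bool) : bernWeight p (flipBits T x) = bernWeight p x := by
  refine Finset.prod_congr rfl fun i _ => ?_
  by_cases h : i ∈ T
  · rw [hp i h]; norm_num
  · simp [flipBits, h]

lemma onesIn_univ (F : Finset ι) (x : ι → Bool) :
    onesIn univ x = onesIn F x + onesIn Fᶜ x := by
  unfold onesIn
  rw [← Finset.card_union_of_disjoint, ← Finset.filter_union, Finset.union_compl]
  exact Finset.disjoint_filter_filter disjoint_compl_right

lemma card_powerset_flipBits (F : Finset ι) (x : ι → Bool) (m : ℕ) :
    ∑ T ∈ F.powerset, (if onesIn univ (flipBits T x) = m then (1 : ℝ) else 0) =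
      if onesIn Fᶜ x ≤ m then ((#F).choose (m - onesIn Fᶜ x) : ℝ) else 0 := by
  have h1 : ∀ T ∈ F.powerset, onesIn univ (flipBits T x) =
      #(symmDiff T {i ∈ F | x i = true}) + onesIn Fᶜ x := by
    intro T hT
    rw [Finset.mem_powerset] at hT
    rw [onesIn_univ F]
    congr 1
    · unfold onesIn
      congr 1
      ext i
      have := @hT i
      by_cases hi : i ∈ T <;> by_cases hF : i ∈ F <;> cases hx : x i <;>
        simp_all [flipBits, Finset.mem_symmDiff]
    · unfold onesIn
      congr 1
      refine Finset.filter_congr fun i hi => ?_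
      have : i ∉ T := fun h => (Finset.mem_compl.1 hi) (hT h)
      simp [flipBits, this]
  have h2 : ∑ T ∈ F.powerset, (if onesIn univ (flipBits T x) = m then (1 : ℝ) else 0) =
      ∑ U ∈ F.powerset, if #U + onesIn Fᶜ x = m then (1 : ℝ) else 0 := by
    refine Finset.sum_nbij' (fun T => symmDiff T {i ∈ F | x i = true})
      (fun T => symmDiff T {i ∈ F | x i = true}) ?_ ?_ ?_ ?_ ?_
    · intro T hT
      rw [Finset.mem_powerset] at hT ⊢
      exact symmDiff_le_iff.2 ⟨hT.trans le_sup_right,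
        (Finset.filter_subset _ _).trans le_sup_right⟩
    · intro T hT
      rw [Finset.mem_powerset] at hT ⊢
      exact symmDiff_le_iff.2 ⟨hT.trans le_sup_right,
        (Finset.filter_subset _ _).trans le_sup_right⟩
    · intro T _; exact symmDiff_symmDiff_cancel_right _ _
    · intro T _; exact symmDiff_symmDiff_cancel_right _ _
    · intro T hT; rw [h1 T hT]
  rw [h2, Finset.sum_boole]
  split_ifs with h
  · rw [← Finset.card_powersetCard, Finset.powersetCard_eq_filter]
    congr 2
    refine Finset.filter_congr fun U _ => by omega
  · rw [Finset.filter_false_of_mem fun U _ => by omega]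
    simp

/-- Conditioning on the coordinates outside a set `F` of fair coins: the number of ones in `F` is
binomially distributed, so a layer meets each fibre in a binomial proportion. -/
lemma sum_layer_eq {p : ι → ℝ} {F : Finset ι} (hF : ∀ i ∈ F, p i = 1 / 2)
    {g : (ι → Bool) → ℝ} (hg : ∀ T ⊆ F, ∀ x, g (flipBits T x) = g x) (m : ℕ) :
    ∑ x, bernWeight p x * (if onesIn univ x = m then g x else 0) =
      ∑ x, bernWeight p x * g x *
        ((if onesIn Fᶜ x ≤ m then ((#F).choose (m - onesIn Fᶜ x) : ℝ) else 0) / 2 ^ #F) := by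
  have h : (2 : ℝ) ^ #F * ∑ x, bernWeight p x * (if onesIn univ x = m then g x else 0) =
      ∑ T ∈ F.powerset, ∑ x, bernWeight p x * g x *
        (if onesIn univ (flipBits T x) = m then (1 : ℝ) else 0) := by
    refine Eq.trans ?_ (Finset.sum_congr rfl (f := fun _ =>
      ∑ x, bernWeight p x * (if onesIn univ x = m then g x else 0)) (fun T hT => ?_))
    · rw [Finset.sum_const, Finset.card_powerset, nsmul_eq_mul]
      push_cast; rfl
    · rw [Finset.mem_powerset] at hT
      rw [← sum_flipBits T (fun x => bernWeight p x * (if onesIn univ x = m then g x else 0))]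
      refine Finset.sum_congr rfl fun x _ => ?_
      rw [bernWeight_flipBits fun i hi => hF i (hT hi), hg T hT]
      split_ifs <;> simp
  rw [Finset.sum_comm] at h
  simp only [← Finset.mul_sum, card_powerset_flipBits] at h
  have h2 : (2 : ℝ) ^ #F ≠ 0 := by positivity
  rw [← mul_right_inj' h2, h, Finset.mul_sum]
  refine Finset.sum_congr rfl fun x _ => ?_
  field_simp

lemma sum_layer_le {p : ι → ℝ} (hp : ∀ i, 0 ≤ p i ∧ p i ≤ 1) {F : Finset ι} {r : ℕ}
    (hr : #F = 2 * r) (hF : ∀ i ∈ F, p i = 1 / 2) {g : (ι → Bool) → ℝ} (hg0 : ∀ x, 0 ≤ g x)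
    (hg : ∀ T ⊆ F, ∀ x, g (flipBits T x) = g x) (m : ℕ) :
    ∑ x, bernWeight p x * (if onesIn univ x = m then g x else 0) ≤
      1 / √(2 * r + 1) * ∑ x, bernWeight p x * g x := by
  rw [sum_layer_eq hF hg, Finset.mul_sum]
  refine Finset.sum_le_sum fun x _ => ?_
  rw [mul_comm (1 / √(2 * r + 1))]
  refine mul_le_mul_of_nonneg_left ?_ (mul_nonneg (bernWeight_nonneg hp x) (hg0 x))
  rw [hr, pow_mul]
  norm_num only
  split_ifs
  · exact choose_div_four_pow_le _ _
  · rw [zero_div]; positivity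

omit [Fintype ι] [DecidableEq ι] in
lemma onesIn_eq_sum (S : Finset ι) (x : ι → Bool) :
    (onesIn S x : ℝ) = ∑ i ∈ S, if x i then (1 : ℝ) else 0 := by
  simp [onesIn]

/-- If all coordinates outside `H` are fair coins and those in `H` have mean `1 / 2` on average,
the middle layer has mass at least of order `1 / √n`, also jointly with the event `x i = true`. -/
lemma le_sum_layer {p : ι → ℝ} (hp : ∀ i, 1 / 4 ≤ p i ∧ p i ≤ 3 / 4) {H : Finset ι} {r : ℕ}
    (hr : #Hᶜ = 2 * r) (hF : ∀ i ∉ H, p i = 1 / 2) (hmean : ∑ i ∈ H, p i = #H / 2)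
    (hH : 0 < #H) (hHr : 8 * #H + 1 ≤ r) {m : ℕ} (hm : |(m : ℝ) - r - #H / 2| ≤ 1 / 2) {i : ι}
    (hi : i ∈ H) :
    1 / (32 * √r) ≤
      ∑ x, bernWeight p x * (if onesIn univ x = m then (if x i then (1 : ℝ) else 0) else 0) := by
  have hp' : ∀ i, 0 ≤ p i ∧ p i ≤ 1 := fun i => ⟨by linarith [hp i], by linarith [hp i]⟩
  have hH' : (0 : ℝ) < #H := by exact_mod_cast hH
  have hHr' : 8 * (#H : ℝ) + 1 ≤ r := by exact_mod_cast hHr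
  have hr1 : 1 ≤ r := by omega
  have hr0 : (0 : ℝ) < r := by linarith
  have hs0 : 0 < √(r : ℝ) := Real.sqrt_pos.2 hr0
  rw [sum_layer_eq (F := Hᶜ) (fun i hi => hF i (Finset.mem_compl.1 hi)) (fun T hT x => by
    have : i ∉ T := fun h => Finset.mem_compl.1 (hT h) hi
    simp [flipBits, this])]
  rw [compl_compl, hr]
  -- the binomial proportion is at least half its maximum when the number of ones in `H` is within
  -- `√(2 #H)` of its mean, and the right-hand side is negative otherwise
  have hpt : ∀ x : ι → Bool, 1 / (4 * √r) * (1 - ((onesIn H x : ℝ) - #H / 2) ^ 2 / (2 * #H)) ≤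
      (if onesIn H x ≤ m then ((2 * r).choose (m - onesIn H x) : ℝ) else 0) / 2 ^ (2 * r) := by
    intro x
    set a := onesIn H x
    rcases le_or_gt (2 * (#H : ℝ)) (((a : ℝ) - #H / 2) ^ 2) with hbad | hgood
    · have : 1 - ((a : ℝ) - #H / 2) ^ 2 / (2 * #H) ≤ 0 := by
        rw [sub_nonpos, le_div_iff₀ (by positivity)]; linarith
      refine (mul_nonpos_of_nonneg_of_nonpos (by positivity) this).trans ?_
      split_ifs <;> positivity
    · set t : ℤ := (m : ℤ) - a - r with ht
      have htr : (t : ℝ) = (m : ℝ) - a - r := by rw [ht]; push_cast; ring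
      have ht2 : (t : ℝ) ^ 2 ≤ r / 2 := by
        rw [abs_le] at hm
        have e : (t : ℝ) = (m - r - #H / 2) - (a - #H / 2) := by rw [htr]; ring
        have h3 : ((m : ℝ) - r - #H / 2) ^ 2 ≤ 1 / 4 := by nlinarith
        rw [e]
        nlinarith [sq_nonneg ((m - r - #H / 2 : ℝ) + (a - #H / 2))]
      have hn : ((t.natAbs : ℕ) : ℝ) ^ 2 = (t : ℝ) ^ 2 := by
        rw [Nat.cast_natAbs, Int.cast_abs, sq_abs]
      have hnr : t.natAbs ≤ r := by
        have h1 : ((t.natAbs : ℕ) : ℝ) ^ 2 ≤ (r : ℝ) := by rw [hn]; linarith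
        have h2 : t.natAbs ^ 2 ≤ r := by exact_mod_cast h1
        nlinarith
      have ham : a ≤ m := by omega
      have hch : (2 * r).choose (m - a) = (2 * r).choose (r + t.natAbs) := by
        rcases le_total 0 t with h | h
        · congr 1; omega
        · rw [← Nat.choose_symm (by omega)]; congr 1; omega
      rw [if_pos ham, hch, pow_mul]
      norm_num only
      have h1 := sub_sq_div_mul_centralBinom_le hr1 t.natAbs
      rw [hn] at h1
      have h2 := le_centralBinom_div_four_pow hr1
      have h3 : (1 : ℝ) / 2 ≤ 1 - (t : ℝ) ^ 2 / r := by
        have : (t : ℝ) ^ 2 / r ≤ 1 / 2 := by rw [div_le_iff₀ hr0]; linarith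
        linarith
      have hc : (0 : ℝ) ≤ r.centralBinom := Nat.cast_nonneg _
      calc 1 / (4 * √r) * (1 - ((a : ℝ) - #H / 2) ^ 2 / (2 * #H)) ≤ 1 / (4 * √r) * 1 := by
            refine mul_le_mul_of_nonneg_left ?_ (by positivity)
            have : 0 ≤ ((a : ℝ) - #H / 2) ^ 2 / (2 * #H) := by positivity
            linarith
        _ = 1 / 2 * (1 / (2 * √r)) := by field_simp; norm_num
        _ ≤ 1 / 2 * ((r.centralBinom : ℝ) / 4 ^ r) := by linarith
        _ = (1 / 2 * r.centralBinom) / 4 ^ r := by ring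
        _ ≤ _ := by
            refine div_le_div_of_nonneg_right ?_ (by positivity)
            nlinarith
  have hvar : ∑ x, bernWeight p x * ((onesIn H x : ℝ) - #H / 2) ^ 2 ≤ (#H : ℝ) / 4 := by
    have e : ∀ x : ι → Bool, (onesIn H x : ℝ) - #H / 2 =
        ∑ i ∈ H, ((if x i then (1 : ℝ) else 0) - p i) := by
      intro x
      rw [Finset.sum_sub_distrib, hmean, onesIn_eq_sum]
    simp only [e]
    rw [sum_bernWeight_variance]
    calc ∑ i ∈ H, p i * (1 - p i) ≤ ∑ i ∈ H, (1 / 4 : ℝ) :=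
          Finset.sum_le_sum fun i _ => by nlinarith [sq_nonneg (p i - 1 / 2)]
      _ = #H / 4 := by simp; ring
  have hpi : ∑ x, bernWeight p x * (if x i then (1 : ℝ) else 0) = p i := by
    rw [sum_bernWeight_mul_coord p i (fun b => if b then (1 : ℝ) else 0)]; simp
  calc 1 / (32 * √r) = 1 / (4 * √r) * (1 / 4 - (#H / 4) / (2 * #H)) := by field_simp; norm_num
    _ ≤ 1 / (4 * √r) * (p i -
          (∑ x, bernWeight p x * ((onesIn H x : ℝ) - #H / 2) ^ 2) / (2 * #H)) := by
        refine mul_le_mul_of_nonneg_left ?_ (by positivity)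
        have := div_le_div_of_nonneg_right hvar (by positivity : 0 ≤ 2 * (#H : ℝ))
        linarith [hp i]
    _ = 1 / (4 * √r) * ∑ x, (bernWeight p x * (if x i then (1 : ℝ) else 0) -
          bernWeight p x * (((onesIn H x : ℝ) - #H / 2) ^ 2 / (2 * #H))) := by
        rw [Finset.sum_sub_distrib, hpi, Finset.sum_div]
        simp only [mul_div_assoc]
    _ ≤ _ := by
        rw [Finset.mul_sum]
        refine Finset.sum_le_sum fun x _ => ?_
        have hw := bernWeight_nonneg hp' x
        have hx := mul_le_mul_of_nonneg_left (hpt x) hw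
        cases x i
        · have : 0 ≤ bernWeight p x * (((onesIn H x : ℝ) - #H / 2) ^ 2 / (2 * #H)) := by positivity
          simp only [Bool.false_eq_true, if_false, mul_zero, zero_mul, zero_sub]
          exact mul_nonpos_of_nonneg_of_nonpos (by positivity) (by linarith)
        · simp only [if_true, mul_one]
          refine le_trans (le_of_eq ?_) hx
          ring

end Layers

/-! ### Random biases -/

section RandomBias

open MeasureTheory ProbabilityTheory

/-- The uniform distribution on `[-1/2, 1/2]`. -/
noncomputable def unifMeasure : Measure ℝ := volume.restrict (Set.Icc (-(1 / 2)) (1 / 2))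

instance : IsProbabilityMeasure unifMeasure := ⟨by
  rw [unifMeasure, Measure.restrict_apply_univ, Real.volume_Icc]; norm_num⟩

lemma hasSubgaussianMGF_unifMeasure :
    HasSubgaussianMGF (fun s : ℝ => s) (1 / 4) unifMeasure := by
  have h := hasSubgaussianMGF_of_mem_Icc_of_integral_eq_zero (μ := unifMeasure)
    (X := fun s : ℝ => s) (a := -(1 / 2)) (b := 1 / 2) aemeasurable_id
    ((ae_restrict_iff' measurableSet_Icc).2 (Filter.Eventually.of_forall fun _ h => h)) (by
      rw [unifMeasure, integral_Icc_eq_integral_Ioc,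
        ← intervalIntegral.integral_of_le (by norm_num), integral_id]
      norm_num)
  convert h using 1
  ext
  norm_num

variable {ι κ : Type*} [Fintype ι] [Fintype κ] [DecidableEq κ]

/-- The bias that the signals `ε` give to the bit `i`, when the signal `j` acts on it with
strength `a i j`. -/
def bias (a : ι → κ → ℝ) (ε : κ → ℝ) (i : ι) : ℝ := ∑ j, ε j * a i j

/-- The signals that bias no bit by more than `1 / 4`. -/
def goodSignals (a : ι → κ → ℝ) : Set (κ → ℝ) := {ε | ∀ i, |bias a ε i| ≤ 1 / 4}

omit [Fintype ι] [DecidableEq κ] in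
lemma continuous_bias (a : ι → κ → ℝ) (i : ι) : Continuous fun ε => bias a ε i := by
  unfold bias; fun_prop

omit [Fintype ι] [DecidableEq κ] in
lemma measurableSet_goodSignals (a : ι → κ → ℝ) : MeasurableSet (goodSignals a) := by
  have : goodSignals a = ⋂ i, {ε | |bias a ε i| ≤ 1 / 4} := by
    ext; simp [goodSignals]
  rw [this]
  exact (isClosed_iInter fun i =>
    isClosed_le (continuous_bias a i).abs continuous_const).measurableSet

omit [Fintype ι] in
lemma bias_update (a : ι → κ → ℝ) (ε : κ → ℝ) (j : κ) (s : ℝ) (i : ι) :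
    bias a (Function.update ε j s) i = (bias a ε i - ε j * a i j) + s * a i j := by
  unfold bias
  rw [← Finset.add_sum_erase _ _ (Finset.mem_univ j),
    ← Finset.add_sum_erase (f := fun j => ε j * a i j) _ (Finset.mem_univ j)]
  rw [Finset.sum_congr rfl fun k hk => by
    rw [Function.update_of_ne (Finset.ne_of_mem_erase hk)]]
  simp
  ring

omit [DecidableEq κ] [Fintype ι] in
lemma measureReal_bias_ge (a : ι → κ → ℝ) (i : ι) {V : ℝ} (hV : ∑ j, a i j ^ 2 ≤ V) :
    (Measure.pi fun _ : κ => unifMeasure).real {ε | 1 / 4 ≤ bias a ε i} ≤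
      Real.exp (-1 / (8 * V)) := by
  have hV0 : 0 ≤ V := (Finset.sum_nonneg fun j _ => sq_nonneg (a i j)).trans hV
  have hind : iIndepFun (fun (j : κ) (ε : κ → ℝ) => a i j * ε j)
      (Measure.pi fun _ : κ => unifMeasure) :=
    iIndepFun_pi (X := fun j s => a i j * s) fun j => by fun_prop
  have hsub : ∀ j ∈ (univ : Finset κ), HasSubgaussianMGF (fun ε : κ → ℝ => a i j * ε j)
      (Real.toNNReal (a i j ^ 2 / 4)) (Measure.pi fun _ : κ => unifMeasure) := by
    intro j _
    have h := hasSubgaussianMGF_unifMeasure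
    rw [← (measurePreserving_eval (fun _ : κ => unifMeasure) j).map_eq] at h
    have h' : HasSubgaussianMGF (fun s : ℝ => s) (1 / 4)
      (Measure.map (fun ε : κ → ℝ => ε j) (Measure.pi fun _ : κ => unifMeasure)) := h
    convert (HasSubgaussianMGF.of_map (Y := fun ε : κ → ℝ => ε j)
      (measurable_pi_apply j).aemeasurable h').const_mul (a i j) using 1
    · rfl
    apply NNReal.eq
    rw [Real.coe_toNNReal _ (by positivity)]
    change a i j ^ 2 / 4 = a i j ^ 2 * ((1 / 4 : NNReal) : ℝ)
    push_cast
    ring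
  have hsum := HasSubgaussianMGF.sum_of_iIndepFun hind hsub
  have hsum' : HasSubgaussianMGF (fun ε : κ → ℝ => ∑ j, a i j * ε j)
      (Real.toNNReal (V / 4)) (Measure.pi fun _ : κ => unifMeasure) := by
    refine ⟨hsum.integrable_exp_mul, fun t => (hsum.mgf_le t).trans (Real.exp_le_exp.2 ?_)⟩
    have h1 : ((∑ j, Real.toNNReal (a i j ^ 2 / 4) : NNReal) : ℝ) ≤ V / 4 := by
      rw [NNReal.coe_sum, Finset.sum_congr rfl fun j _ =>
        Real.coe_toNNReal (a i j ^ 2 / 4) (by positivity), ← Finset.sum_div]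
      linarith
    have h2 := mul_le_mul_of_nonneg_right h1 (sq_nonneg t)
    rw [Real.coe_toNNReal _ (by positivity)]
    linarith
  have h := hsum'.measure_ge_le (ε := 1 / 4) (by norm_num)
  have hset : {ε : κ → ℝ | 1 / 4 ≤ bias a ε i} = {ε | 1 / 4 ≤ ∑ j, a i j * ε j} := by
    simp only [bias, mul_comm]
  rw [hset]
  refine h.trans (le_of_eq ?_)
  rw [Real.coe_toNNReal _ (by positivity)]
  congr 1
  rcases hV0.eq_or_lt with h0 | h0
  · rw [← h0]; norm_num
  · field_simp; norm_num

omit [DecidableEq κ] [Fintype ι] in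
lemma le_measureReal_goodSignals [DecidableEq ι] (a : ι → κ → ℝ) {H : Finset ι}
    (hH : ∀ i ∉ H, ∀ j, a i j = 0)
    {V : ℝ} (hV : ∀ i ∈ H, ∑ j, a i j ^ 2 ≤ V) (hHV : #H * Real.exp (-1 / (8 * V)) ≤ 1 / 4) :
    1 / 2 ≤ (Measure.pi fun _ : κ => unifMeasure).real (goodSignals a) := by
  set π := Measure.pi fun _ : κ => unifMeasure
  have hneg : ∀ i ε, bias (fun i j => -a i j) ε i = - bias a ε i := by
    intro i ε; simp [bias]
  have hsub : (goodSignals a)ᶜ ⊆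
      ⋃ i ∈ H, ({ε | 1 / 4 ≤ bias a ε i} ∪ {ε | 1 / 4 ≤ bias (fun i j => -a i j) ε i}) := by
    intro ε hε
    simp only [goodSignals, Set.mem_compl_iff, Set.mem_ofPred_eq, not_forall, not_le] at hε
    obtain ⟨i, hi⟩ := hε
    have hiH : i ∈ H := by
      by_contra h
      have : bias a ε i = 0 := by simp [bias, hH i h]
      rw [this] at hi; norm_num at hi
    simp only [Set.mem_iUnion, Set.mem_union, Set.mem_ofPred_eq, hneg]
    refine ⟨i, hiH, ?_⟩
    rcases lt_abs.1 hi with h | h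
    · exact Or.inl h.le
    · exact Or.inr h.le
  have hb : π.real (goodSignals a)ᶜ ≤ #H * (2 * Real.exp (-1 / (8 * V))) := by
    refine (measureReal_mono hsub (measure_ne_top _ _)).trans ?_
    refine (measureReal_biUnion_finset_le _ _).trans ?_
    rw [← nsmul_eq_mul]
    refine Finset.sum_le_card_nsmul _ _ _ fun i hi => ?_
    refine (measureReal_union_le _ _).trans ?_
    have h1 := measureReal_bias_ge a i (hV i hi)
    have h2 := measureReal_bias_ge (fun i j => -a i j) i (V := V) (by simpa using hV i hi)
    linarith
  rw [probReal_compl_eq_one_sub (measurableSet_goodSignals a)] at hb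
  linarith

variable [DecidableEq ι]

/-- For a fixed `j`, the good values of the signal `j` form an interval, so that the integrated
Margulis–Russo formula applies to it. -/
lemma lintegral_goodSignals_influence_le (a : ι → κ → ℝ) (j : κ) {g : (ι → Bool) → ℝ}
    (hg : Monotone g) (hg0 : ∀ x, 0 ≤ g x) (hg1 : ∀ x, g x ≤ 1) (T : Finset ι) {b : ℝ} (hb : 0 < b)
    (hT : ∀ i ∈ T, b ≤ a i j) (ha : ∀ i, 0 ≤ a i j ∨ ∀ x, g (flipBit i x) = g x) :
    ∫⁻ ε in goodSignals a, ENNReal.ofReal (∑ i ∈ T, influence (fun i => 1 / 2 + bias a ε i) g i)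
      ∂(Measure.pi fun _ : κ => unifMeasure) ≤ ENNReal.ofReal (1 / b) := by
  set F : (κ → ℝ) → ENNReal := fun ε =>
    ENNReal.ofReal (∑ i ∈ T, influence (fun i => 1 / 2 + bias a ε i) g i) with hF
  have hFm : Measurable F := by
    refine ENNReal.measurable_ofReal.comp (Continuous.measurable ?_)
    refine continuous_finsetSum _ fun i _ => (continuous_influence g i).comp ?_
    exact continuous_pi fun i => continuous_const.add (continuous_bias a i)
  rw [← lintegral_indicator (measurableSet_goodSignals a)]
  refine (lintegral_le_of_lmarginal_le (μ := fun _ : κ => unifMeasure) {j}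
    (g := fun _ => ENNReal.ofReal (1 / b))
    (hFm.indicator (measurableSet_goodSignals a)) measurable_const ?_).trans (by simp)
  rw [lmarginal_singleton, lmarginal_singleton]
  intro ε
  simp only [lintegral_const, measure_univ, mul_one]
  set α : ι → ℝ := fun i => bias a ε i - ε j * a i j with hα
  set S : Set ℝ := {s | ∀ i, |α i + s * a i j| ≤ 1 / 4} with hS
  have hmem : ∀ s, Function.update ε j s ∈ goodSignals a ↔ s ∈ S := by
    intro s
    simp only [goodSignals, Set.mem_ofPred_eq, bias_update, hS, hα]
  have hind : ∀ s, (goodSignals a).indicator F (Function.update ε j s) = S.indicator (fun s =>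
      ENNReal.ofReal (∑ i ∈ T, influence (fun i => (1 / 2 + α i) + s * a i j) g i)) s := by
    intro s
    by_cases h : s ∈ S
    · rw [Set.indicator_of_mem h, Set.indicator_of_mem ((hmem s).2 h), hF]
      simp only [bias_update, hα, add_assoc]
    · rw [Set.indicator_of_notMem h, Set.indicator_of_notMem (fun h' => h ((hmem s).1 h'))]
  simp only [hind]
  have hSeq : S = ⋂ i, {s | |α i + s * a i j| ≤ 1 / 4} := by ext; simp [hS]
  have hSclosed : IsClosed S := by
    rw [hSeq]
    exact isClosed_iInter fun i => isClosed_le (by fun_prop) continuous_const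
  have hSconv : Convex ℝ S := by
    intro s hs t ht u v hu hv huv i
    have e : α i + (u • s + v • t) * a i j =
        u * (α i + s * a i j) + v * (α i + t * a i j) := by
      simp only [smul_eq_mul]; linear_combination (-α i) * huv
    rw [e, abs_le]
    have h1 := abs_le.1 (hs i)
    have h2 := abs_le.1 (ht i)
    constructor <;> nlinarith
  rw [lintegral_indicator hSclosed.measurableSet, unifMeasure,
    Measure.restrict_restrict hSclosed.measurableSet]
  rcases (S ∩ Set.Icc (-(1 / 2)) (1 / 2)).eq_empty_or_nonempty with h0 | hne
  · rw [h0]; simp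
  have hcomp : IsCompact (S ∩ Set.Icc (-(1 / 2) : ℝ) (1 / 2)) := isCompact_Icc.inter_left hSclosed
  have hconn : IsConnected (S ∩ Set.Icc (-(1 / 2) : ℝ) (1 / 2)) :=
    ⟨hne, (hSconv.inter (convex_Icc _ _)).isPreconnected⟩
  have hIcc := eq_Icc_of_connected_compact hconn hcomp
  have hcd : sInf (S ∩ Set.Icc (-(1 / 2) : ℝ) (1 / 2)) ≤ sSup (S ∩ Set.Icc (-(1 / 2) : ℝ) (1 / 2)) :=
    Set.nonempty_Icc.1 (hIcc ▸ hne)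
  have hsubS : ∀ s ∈ Set.Icc (sInf (S ∩ Set.Icc (-(1 / 2) : ℝ) (1 / 2)))
      (sSup (S ∩ Set.Icc (-(1 / 2) : ℝ) (1 / 2))), s ∈ S := by
    intro s hs
    rw [← hIcc] at hs
    exact hs.1
  rw [hIcc]
  refine lintegral_sum_influence_le (fun i => 1 / 2 + α i) (fun i => a i j) hg hg0 hg1 T hb hT ha
    hcd fun s hs i => ?_
  have := abs_le.1 (hsubS s hs i)
  constructor <;> linarith

/-- Some choice of signals makes the total influence of the functions `g j` on the sets `T j`
as small as the speeds at which the signals move the biases allow. -/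
lemma exists_goodSignals_sum_influence_le (a : ι → κ → ℝ) {H : Finset ι}
    (hH : ∀ i ∉ H, ∀ j, a i j = 0)
    {V : ℝ} (hV : ∀ i ∈ H, ∑ j, a i j ^ 2 ≤ V) (hHV : #H * Real.exp (-1 / (8 * V)) ≤ 1 / 4)
    {g : κ → (ι → Bool) → ℝ} (hg : ∀ j, Monotone (g j)) (hg0 : ∀ j x, 0 ≤ g j x)
    (hg1 : ∀ j x, g j x ≤ 1) (T : κ → Finset ι) {b : ℝ} (hb : 0 < b)
    (hT : ∀ j, ∀ i ∈ T j, b ≤ a i j)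
    (ha : ∀ j i, 0 ≤ a i j ∨ ∀ x, g j (flipBit i x) = g j x) :
    ∃ ε ∈ goodSignals a, ∑ j, ∑ i ∈ T j, influence (fun i => 1 / 2 + bias a ε i) (g j) i ≤
      2 * Fintype.card κ / b := by
  set π := Measure.pi fun _ : κ => unifMeasure
  have hgood := le_measureReal_goodSignals a hH hV hHV
  have hgood' : (2 : ENNReal)⁻¹ ≤ π (goodSignals a) := by
    rw [← ofReal_measureReal (measure_ne_top _ _)]
    refine le_trans (le_of_eq ?_) (ENNReal.ofReal_le_ofReal hgood)
    rw [one_div, ENNReal.ofReal_inv_of_pos (by norm_num)]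
    norm_num
  have hm : ∀ j, Measurable fun ε : κ → ℝ =>
      ENNReal.ofReal (∑ i ∈ T j, influence (fun i => 1 / 2 + bias a ε i) (g j) i) := by
    intro j
    refine ENNReal.measurable_ofReal.comp (Continuous.measurable ?_)
    refine continuous_finsetSum _ fun i _ => (continuous_influence (g j) i).comp ?_
    exact continuous_pi fun i => continuous_const.add (continuous_bias a i)
  obtain ⟨ε, hε, hle⟩ := exists_le_setLAverage (μ := π) (s := goodSignals a)
    (f := fun ε => ∑ j, ENNReal.ofReal
      (∑ i ∈ T j, influence (fun i => 1 / 2 + bias a ε i) (g j) i))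
    (fun h => by rw [h] at hgood'; simp at hgood') (measure_ne_top _ _)
    (Finset.measurable_fun_sum _ fun j _ => hm j).aemeasurable
  refine ⟨ε, hε, ?_⟩
  have hp : ∀ i, 0 ≤ 1 / 2 + bias a ε i ∧ 1 / 2 + bias a ε i ≤ 1 := fun i => by
    have := abs_le.1 (hε i)
    constructor <;> linarith
  rw [setLAverage_eq, lintegral_finsetSum _ fun j _ => hm j,
    ← ENNReal.ofReal_sum_of_nonneg fun j _ =>
      Finset.sum_nonneg fun i _ => influence_nonneg hp (g j) i] at hle
  have h1 : ∑ j, ∫⁻ ε in goodSignals a, ENNReal.ofReal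
      (∑ i ∈ T j, influence (fun i => 1 / 2 + bias a ε i) (g j) i) ∂π ≤
      ENNReal.ofReal (Fintype.card κ / b) := by
    refine (Finset.sum_le_sum fun j _ => lintegral_goodSignals_influence_le a j (hg j) (hg0 j)
      (hg1 j) (T j) hb (hT j) (ha j)).trans (le_of_eq ?_)
    rw [Finset.sum_const, Finset.card_univ, nsmul_eq_mul, ← ENNReal.ofReal_natCast,
      ← ENNReal.ofReal_mul (Nat.cast_nonneg _)]
    congr 1
    ring
  have h2 := hle.trans (ENNReal.div_le_div h1 hgood')
  rw [ENNReal.div_eq_inv_mul, inv_inv, ← ENNReal.ofReal_ofNat 2,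
    ← ENNReal.ofReal_mul (by norm_num)] at h2
  have h3 := (ENNReal.ofReal_le_ofReal_iff (by positivity)).1 h2
  rwa [mul_div_assoc]

end RandomBias

/-! ### Depth-two circuits for majority -/

section Circuits

lemma ThresholdGate.eval_mono {ι : Type} [Fintype ι] (G : ThresholdGate ι) : Monotone G.eval := by
  intro x y hxy
  unfold ThresholdGate.eval
  rw [Bool.le_iff_imp, decide_eq_true_eq, decide_eq_true_eq]
  intro h
  refine h.trans (Finset.sum_le_sum fun i _ => mul_le_mul_of_nonneg_left ?_ (by positivity))
  have := Bool.le_iff_imp.1 (hxy i)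
  cases hx : x i <;> cases hy : y i <;> simp_all

lemma ThresholdGate.eval_congr {ι : Type} [Fintype ι] (G : ThresholdGate ι) {x y : ι → Bool}
    (h : ∀ i, 0 < G.weight i → x i = y i) : G.eval x = G.eval y := by
  unfold ThresholdGate.eval
  congr 2
  refine Finset.sum_congr rfl fun i _ => ?_
  rcases Nat.eq_zero_or_pos (G.weight i) with h0 | h0
  · simp [h0]
  · rw [h i h0]

/-- The value of a gate as a real number. -/
def gateValue {ι : Type} [Fintype ι] (G : ThresholdGate ι) (x : ι → Bool) : ℝ :=
  if G.eval x then 1 else 0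

lemma gateValue_mono {ι : Type} [Fintype ι] (G : ThresholdGate ι) : Monotone (gateValue G) := by
  intro x y hxy
  have := Bool.le_iff_imp.1 (G.eval_mono hxy)
  unfold gateValue
  cases hx : G.eval x <;> cases hy : G.eval y <;> simp_all

lemma gateValue_nonneg {ι : Type} [Fintype ι] (G : ThresholdGate ι) (x : ι → Bool) :
    0 ≤ gateValue G x := by
  unfold gateValue; split_ifs <;> norm_num

lemma gateValue_le_one {ι : Type} [Fintype ι] (G : ThresholdGate ι) (x : ι → Bool) :
    gateValue G x ≤ 1 := by
  unfold gateValue; split_ifs <;> norm_num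

lemma majority_eq {n : ℕ} (x : Fin n → Bool) :
    majority n x = decide (n ≤ 2 * onesIn univ x) := by
  unfold majority onesIn
  congr 1
  rw [Finset.sum_boole, eq_iff_iff, div_le_iff₀ (by norm_num), mul_comm]
  exact_mod_cast Iff.rfl

lemma onesIn_flipBit {n : ℕ} {x : Fin n → Bool} {i : Fin n} (hi : x i = true) :
    onesIn univ (flipBit i x) + 1 = onesIn univ x := by
  unfold onesIn
  have : ({l ∈ univ | flipBit i x l = true} : Finset (Fin n)) =
      ({l ∈ univ | x l = true} : Finset (Fin n)).erase i := by
    ext l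
    by_cases h : l = i
    · subst h; simp [flipBit, hi]
    · rw [Finset.mem_erase, Finset.mem_filter, Finset.mem_filter, flipBit_apply_of_ne h]
      simp [h]
  rw [this, Finset.card_erase_add_one (by simpa using hi)]

/-- On the lowest layer where the majority is `1`, negating a one changes the value of the
circuit, hence of some bottom gate. -/
lemma exists_gate_pivotal {n : ℕ} {C : DepthTwoCircuit n}
    (hC : ∀ x : Fin n → Bool, C.eval x = majority n x) {x : Fin n → Bool}
    (hx : onesIn univ x = (n + 1) / 2) {i : Fin n} (hi : x i = true) :
    ∃ j, 0 < (C.bottom j).weight i ∧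
      |gateValue (C.bottom j) x - gateValue (C.bottom j) (flipBit i x)| = 1 := by
  have h1 : C.eval x = true := by
    rw [hC, majority_eq, decide_eq_true_eq]; omega
  have h2 : C.eval (flipBit i x) = false := by
    have := onesIn_flipBit hi
    rw [hC, majority_eq, decide_eq_false_iff_not]; omega
  have h3 : ∃ j, (C.bottom j).eval x ≠ (C.bottom j).eval (flipBit i x) := by
    by_contra! h
    have : C.eval x = C.eval (flipBit i x) := by
      unfold DepthTwoCircuit.eval
      simp only [h]
    rw [h1, h2] at this
    exact absurd this (by decide)
  obtain ⟨j, hj⟩ := h3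
  refine ⟨j, Nat.pos_of_ne_zero fun h0 => hj ((C.bottom j).eval_congr fun l hl => ?_), ?_⟩
  · have : l ≠ i := fun h => by rw [h, h0] at hl; exact lt_irrefl _ hl
    rw [flipBit_apply_of_ne this]
  · unfold gateValue
    cases h : (C.bottom j).eval x <;> cases h' : (C.bottom j).eval (flipBit i x) <;> simp_all

lemma numGates_le {n k : ℕ} {C : DepthTwoCircuit n} (hk : C.IsMajMaj k) : C.numGates ≤ k := by
  refine le_trans ?_ hk.1
  unfold ThresholdGate.totalWeight
  calc C.numGates = ∑ _j : Fin C.numGates, 1 := by simp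
    _ ≤ _ := Finset.sum_le_sum fun j _ => C.top_pos j

lemma card_support_le {n k : ℕ} {C : DepthTwoCircuit n} (hk : C.IsMajMaj k)
    (j : Fin C.numGates) : #{i | 0 < (C.bottom j).weight i} ≤ k := by
  refine le_trans ?_ (hk.2 j)
  unfold ThresholdGate.totalWeight
  rw [Finset.card_filter]
  exact Finset.sum_le_sum fun i _ => by split_ifs <;> omega

/-- A circuit with `k = 0` has no gates and is constant. -/
lemma one_le_of_computes {n k : ℕ} (hn : 2 ≤ n) {C : DepthTwoCircuit n} (hk : C.IsMajMaj k)
    (hC : ∀ x : Fin n → Bool, C.eval x = majority n x) : 1 ≤ k := by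
  by_contra h
  have hN : C.numGates = 0 := by have := numGates_le hk; omega
  have : C.eval (fun _ => true) = C.eval (fun _ => false) := by
    unfold DepthTwoCircuit.eval
    congr 1
    funext j
    exact absurd j.2 (by omega)
  rw [hC, hC, majority_eq, majority_eq] at this
  simp [onesIn] at this
  omega

/-- The number of bottom gates that read the variable `i`. -/
def readCount {n : ℕ} (C : DepthTwoCircuit n) (i : Fin n) : ℕ :=
  #{j | 0 < (C.bottom j).weight i}

lemma sum_readCount {n : ℕ} (C : DepthTwoCircuit n) (H : Finset (Fin n)) :
    ∑ i ∈ H, readCount C i = ∑ j, #{i ∈ H | 0 < (C.bottom j).weight i} := by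
  simp only [readCount, Finset.card_filter]
  exact Finset.sum_comm

/-- By Markov's inequality at least three quarters of the variables are read by at most four times
the average number of gates. -/
lemma three_mul_le_card_light {n k : ℕ} (hk1 : 1 ≤ k) {C : DepthTwoCircuit n}
    (hk : C.IsMajMaj k) : 3 * n ≤ 4 * #{i | n * readCount C i ≤ 4 * k ^ 2} := by
  have hsum : ∑ i, readCount C i ≤ k ^ 2 := by
    rw [sum_readCount]
    calc _ ≤ ∑ _j : Fin C.numGates, k := Finset.sum_le_sum fun j _ => card_support_le hk j
      _ = C.numGates * k := by simp
      _ ≤ k ^ 2 := by rw [sq]; exact Nat.mul_le_mul_right _ (numGates_le hk)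
  have hpart := Finset.card_filter_add_card_filter_not (s := (univ : Finset (Fin n)))
    (fun i => n * readCount C i ≤ 4 * k ^ 2)
  rw [Finset.card_univ, Fintype.card_fin] at hpart
  have hheavy : #{i | ¬ n * readCount C i ≤ 4 * k ^ 2} * (4 * k ^ 2) ≤ n * k ^ 2 := by
    calc _ = ∑ _i ∈ ({i | ¬ n * readCount C i ≤ 4 * k ^ 2} : Finset (Fin n)), 4 * k ^ 2 := by simp
      _ ≤ ∑ i ∈ ({i | ¬ n * readCount C i ≤ 4 * k ^ 2} : Finset (Fin n)), n * readCount C i :=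
          Finset.sum_le_sum fun i hi => (not_le.1 (Finset.mem_filter.1 hi).2).le
      _ ≤ ∑ i, n * readCount C i := Finset.sum_le_sum_of_subset (Finset.subset_univ _)
      _ = n * ∑ i, readCount C i := by rw [Finset.mul_sum]
      _ ≤ n * k ^ 2 := Nat.mul_le_mul_left _ hsum
  have hk2 : 0 < k ^ 2 := by positivity
  have : 4 * #{i | ¬ n * readCount C i ≤ 4 * k ^ 2} ≤ n := by
    refine Nat.le_of_mul_le_mul_right (c := k ^ 2) ?_ hk2
    calc _ = #{i | ¬ n * readCount C i ≤ 4 * k ^ 2} * (4 * k ^ 2) := by ring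
      _ ≤ _ := hheavy
  omega

/-- The strength with which the signal of the gate `j` acts on the variable `i`: it pushes the
variables in `H` read by the gate, and is centred so as not to move the mean number of ones. -/
noncomputable def signalStrength {n : ℕ} (C : DepthTwoCircuit n) (H : Finset (Fin n)) (u : ℝ)
    (i : Fin n) (j : Fin C.numGates) : ℝ :=
  if i ∈ H then u * ((if 0 < (C.bottom j).weight i then 1 else 0) -
    (#{i ∈ H | 0 < (C.bottom j).weight i} : ℝ) / #H) else 0

lemma sum_signalStrength {n : ℕ} (C : DepthTwoCircuit n) {H : Finset (Fin n)} (hH : 0 < #H) (u : ℝ)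
    (j : Fin C.numGates) : ∑ i ∈ H, signalStrength C H u i j = 0 := by
  have hH' : (#H : ℝ) ≠ 0 := by exact_mod_cast hH.ne'
  rw [Finset.sum_congr rfl fun i hi => by rw [signalStrength, if_pos hi], ← Finset.mul_sum,
    Finset.sum_sub_distrib, Finset.sum_boole, Finset.sum_const, nsmul_eq_mul]
  field_simp
  ring

lemma sum_signalStrength_sq_le {n : ℕ} (C : DepthTwoCircuit n) {H : Finset (Fin n)} (hH : 0 < #H)
    (u : ℝ) {D : ℝ} (hD : ∀ i ∈ H, (readCount C i : ℝ) ≤ D) {i : Fin n} (hi : i ∈ H) :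
    ∑ j, signalStrength C H u i j ^ 2 ≤ u ^ 2 * (2 * D) := by
  have hH' : (0 : ℝ) < #H := by exact_mod_cast hH
  have hterm : ∀ j, signalStrength C H u i j ^ 2 ≤
      u ^ 2 * ((if 0 < (C.bottom j).weight i then 1 else 0) +
        (#{i ∈ H | 0 < (C.bottom j).weight i} : ℝ) / #H) := by
    intro j
    rw [signalStrength, if_pos hi, mul_pow]
    refine mul_le_mul_of_nonneg_left ?_ (sq_nonneg u)
    have h0 : (0 : ℝ) ≤ (#{i ∈ H | 0 < (C.bottom j).weight i} : ℝ) / #H := by positivity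
    have h1 : (#{i ∈ H | 0 < (C.bottom j).weight i} : ℝ) / #H ≤ 1 := by
      rw [div_le_one hH']
      exact_mod_cast Finset.card_filter_le _ _
    split_ifs <;> nlinarith
  refine (Finset.sum_le_sum fun j _ => hterm j).trans ?_
  rw [← Finset.mul_sum]
  refine mul_le_mul_of_nonneg_left ?_ (sq_nonneg u)
  rw [Finset.sum_add_distrib, Finset.sum_boole, ← Finset.sum_div]
  have h1 : (#{j | 0 < (C.bottom j).weight i} : ℝ) ≤ D := hD i hi
  have h2 : (∑ j, (#{i ∈ H | 0 < (C.bottom j).weight i} : ℝ)) / #H ≤ D := by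
    rw [div_le_iff₀ hH']
    have := sum_readCount C H
    have h3 : (∑ i ∈ H, (readCount C i : ℝ)) =
      ∑ j, (#{i ∈ H | 0 < (C.bottom j).weight i} : ℝ) := by exact_mod_cast this
    rw [← h3, mul_comm, ← nsmul_eq_mul]
    exact Finset.sum_le_card_nsmul _ _ _ hD
  linarith

/-- The two estimates of the mean number of pivotal gates on the middle layer, compared. -/
lemma layer_le_sum_influence {n k : ℕ} {C : DepthTwoCircuit n} (hk : C.IsMajMaj k)
    (hC : ∀ x : Fin n → Bool, C.eval x = majority n x) {p : Fin n → ℝ}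
    (hp : ∀ i, 1 / 4 ≤ p i ∧ p i ≤ 3 / 4) {H : Finset (Fin n)} {r q : ℕ} (hr : #Hᶜ = 2 * r)
    (hF : ∀ i ∉ H, p i = 1 / 2) (hmean : ∑ i ∈ H, p i = #H / 2) (hH : 0 < #H)
    (hHr : 8 * #H + 1 ≤ r) (hq : #H + k + 2 * q ≤ n) :
    #H * (1 / (32 * √r)) ≤ 1 / √(2 * q + 1) *
      ∑ j, ∑ i ∈ H with 0 < (C.bottom j).weight i, influence p (gateValue (C.bottom j)) i := by
  have hp' : ∀ i, 0 ≤ p i ∧ p i ≤ 1 := fun i => ⟨by linarith [hp i], by linarith [hp i]⟩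
  have hcard : #H + 2 * r = n := by
    rw [← hr, Finset.card_add_card_compl, Fintype.card_fin]
  have hm : |(((n + 1) / 2 : ℕ) : ℝ) - r - #H / 2| ≤ 1 / 2 := by
    have h1 : 2 * ((n + 1) / 2) ≤ n + 1 := by omega
    have h2 : n ≤ 2 * ((n + 1) / 2) := by omega
    have h1' : 2 * (((n + 1) / 2 : ℕ) : ℝ) ≤ n + 1 := by exact_mod_cast h1
    have h2' : (n : ℝ) ≤ 2 * (((n + 1) / 2 : ℕ) : ℝ) := by exact_mod_cast h2
    have h3 : (#H : ℝ) + 2 * r = n := by exact_mod_cast hcard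
    rw [abs_le]
    constructor <;> linarith
  calc (#H : ℝ) * (1 / (32 * √r)) = ∑ i ∈ H, 1 / (32 * √r) := by simp
    _ ≤ ∑ i ∈ H, ∑ x, bernWeight p x *
        (if onesIn univ x = (n + 1) / 2 then (if x i then (1 : ℝ) else 0) else 0) :=
      Finset.sum_le_sum fun i hi => le_sum_layer hp hr hF hmean hH hHr hm hi
    _ ≤ ∑ i ∈ H, ∑ x, bernWeight p x * ∑ j, (if 0 < (C.bottom j).weight i then
        (if onesIn univ x = (n + 1) / 2 then
          |gateValue (C.bottom j) x - gateValue (C.bottom j) (flipBit i x)| else 0) else 0) := by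
      refine Finset.sum_le_sum fun i hi => Finset.sum_le_sum fun x _ =>
        mul_le_mul_of_nonneg_left ?_ (bernWeight_nonneg hp' x)
      have hnn : ∀ j ∈ (univ : Finset (Fin C.numGates)),
          0 ≤ (if 0 < (C.bottom j).weight i then (if onesIn univ x = (n + 1) / 2 then
          |gateValue (C.bottom j) x - gateValue (C.bottom j) (flipBit i x)| else 0) else 0) := by
        intro j _
        split_ifs <;> positivity
      by_cases hx : onesIn univ x = (n + 1) / 2
      · by_cases hxi : x i = true
        · obtain ⟨j, hj, hj1⟩ := exists_gate_pivotal hC hx hxi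
          refine le_trans (le_of_eq ?_) (Finset.single_le_sum hnn (Finset.mem_univ j))
          rw [if_pos hx, if_pos hxi, if_pos hj, if_pos hx, hj1]
        · rw [if_pos hx, if_neg hxi]
          exact Finset.sum_nonneg hnn
      · rw [if_neg hx]
        exact Finset.sum_nonneg hnn
    _ = ∑ j, ∑ i ∈ H with 0 < (C.bottom j).weight i, ∑ x, bernWeight p x *
        (if onesIn univ x = (n + 1) / 2 then
          |gateValue (C.bottom j) x - gateValue (C.bottom j) (flipBit i x)| else 0) := by
      simp only [Finset.mul_sum]
      rw [Finset.sum_congr rfl fun i _ => Finset.sum_comm, Finset.sum_comm]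
      refine Finset.sum_congr rfl fun j _ => ?_
      rw [Finset.sum_filter]
      refine Finset.sum_congr rfl fun i _ => ?_
      split_ifs <;> simp
    _ ≤ ∑ j, ∑ i ∈ H with 0 < (C.bottom j).weight i,
        1 / √(2 * q + 1) * influence p (gateValue (C.bottom j)) i := by
      refine Finset.sum_le_sum fun j _ => Finset.sum_le_sum fun i hi => ?_
      -- many fair coins lie outside the support of the gate, and pivotality ignores them
      have hsup := card_support_le hk j
      obtain ⟨F, hFsub, hFcard⟩ := Finset.exists_subset_card_eq
        (s := Hᶜ \ ({i | 0 < (C.bottom j).weight i} : Finset (Fin n))) (n := 2 * q) (by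
          have := Finset.le_card_sdiff ({i | 0 < (C.bottom j).weight i} : Finset (Fin n)) Hᶜ
          omega)
      have hF1 : ∀ i ∈ F, i ∉ H := fun i hi => by
        have := hFsub hi
        rw [Finset.mem_sdiff, Finset.mem_compl] at this
        exact this.1
      have hF2 : ∀ i ∈ F, ¬ 0 < (C.bottom j).weight i := fun i hi => by
        have := hFsub hi
        rw [Finset.mem_sdiff] at this
        simpa using this.2
      have hflip : ∀ T ⊆ F, ∀ x l, 0 < (C.bottom j).weight l → flipBits T x l = x l := by
        intro T hT x l hl
        have : l ∉ T := fun h => hF2 l (hT h) hl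
        simp [flipBits, this]
      refine sum_layer_le hp' hFcard (fun i hi => hF i (hF1 i hi)) (fun x => abs_nonneg _)
        (fun T hT x => ?_) _
      have e1 : (C.bottom j).eval (flipBits T x) = (C.bottom j).eval x :=
        (C.bottom j).eval_congr (hflip T hT x)
      have e2 : (C.bottom j).eval (flipBit i (flipBits T x)) =
          (C.bottom j).eval (flipBit i x) := by
        refine (C.bottom j).eval_congr fun l hl => ?_
        by_cases hli : l = i
        · subst hli
          rw [flipBit_apply_self, flipBit_apply_self, hflip T hT x l hl]
        · rw [flipBit_apply_of_ne hli, flipBit_apply_of_ne hli, hflip T hT x l hl]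
      simp only [gateValue, e1, e2]
    _ = _ := by simp only [← Finset.mul_sum]

/-- The lower bound `k ≥ c n ^ (3/4) / (log n) ^ (1/4)`, for `k` at most a small multiple
of `n`. -/
lemma pow_three_le_mul_log {n k : ℕ} (hn : 10000 ≤ n) (hkn : 200 * k ≤ n) {C : DepthTwoCircuit n}
    (hk : C.IsMajMaj k) (hC : ∀ x : Fin n → Bool, C.eval x = majority n x) :
    (n : ℝ) ^ 3 ≤ 10 ^ 11 * k ^ 4 * Real.log (4 * n) := by
  have hk1 := one_le_of_computes (by omega) hk hC
  have hlight := three_mul_le_card_light hk1 hk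
  -- the parity of `#H` is chosen so that the number of fair coins is even
  set r := (n - n / 64) / 2 with hr
  obtain ⟨H, hHsub, hHcard⟩ := Finset.exists_subset_card_eq
    (s := ({i | n * readCount C i ≤ 4 * k ^ 2} : Finset (Fin n))) (n := n - 2 * r) (by omega)
  have hH0 : 0 < #H := by omega
  have hHr : 8 * #H + 1 ≤ r := by omega
  have hcompl : #Hᶜ = 2 * r := by
    rw [Finset.card_compl, Fintype.card_fin]; omega
  have hnR : (10000 : ℝ) ≤ n := by exact_mod_cast hn
  have hkR : (1 : ℝ) ≤ k := by exact_mod_cast hk1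
  have hHR : (0 : ℝ) < #H := by exact_mod_cast hH0
  set L := Real.log (4 * n) with hL
  have hL0 : 0 < L := Real.log_pos (by linarith)
  set D : ℝ := 4 * k ^ 2 / n with hD
  have hD0 : 0 < D := by positivity
  have hHD : ∀ i ∈ H, (readCount C i : ℝ) ≤ D := by
    intro i hi
    have h1 := (Finset.mem_filter.1 (hHsub hi)).2
    rw [hD, le_div_iff₀ (by linarith), mul_comm]
    exact_mod_cast h1
  -- the largest strength, up to a constant, at which Hoeffding's inequality still lets all biases
  -- stay below `1 / 4` simultaneously
  set u : ℝ := 1 / (4 * √(D * L)) with hu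
  have hDL : 0 < √(D * L) := Real.sqrt_pos.2 (by positivity)
  have hu0 : 0 < u := by positivity
  have hu2 : u ^ 2 * (2 * D) = 1 / (8 * L) := by
    rw [hu, div_pow, mul_pow, Real.sq_sqrt (by positivity)]
    field_simp
    norm_num
  have hsmall : #H * Real.exp (-1 / (8 * (1 / (8 * L)))) ≤ 1 / 4 := by
    have : -1 / (8 * (1 / (8 * L))) = -L := by field_simp
    rw [this, Real.exp_neg, hL, Real.exp_log (by linarith), ← div_eq_mul_inv,
      div_le_iff₀ (by linarith)]
    have : (#H : ℝ) ≤ n := by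
      exact_mod_cast (by omega : #H ≤ n)
    linarith
  obtain ⟨ε, hε, hle⟩ := exists_goodSignals_sum_influence_le (signalStrength C H u) (H := H)
    (fun i hi j => by rw [signalStrength, if_neg hi])
    (fun i hi => (sum_signalStrength_sq_le C hH0 u hHD hi).trans (le_of_eq hu2)) hsmall
    (g := fun j => gateValue (C.bottom j)) (fun j => gateValue_mono _)
    (fun j => gateValue_nonneg _) (fun j => gateValue_le_one _)
    (fun j => {i ∈ H | 0 < (C.bottom j).weight i}) (b := u / 2) (by positivity)
    (fun j i hi => by
      obtain ⟨hiH, hij⟩ := Finset.mem_filter.1 hi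
      rw [signalStrength, if_pos hiH, if_pos hij]
      have h1 : 2 * #{i ∈ H | 0 < (C.bottom j).weight i} ≤ #H := by
        have h2 : #{i ∈ H | 0 < (C.bottom j).weight i} ≤ #{i | 0 < (C.bottom j).weight i} :=
          Finset.card_le_card (Finset.filter_subset_filter _ (Finset.subset_univ _))
        have h3 := card_support_le hk j
        omega
      have h1' : 2 * (#{i ∈ H | 0 < (C.bottom j).weight i} : ℝ) ≤ #H := by exact_mod_cast h1
      have h4 : (#{i ∈ H | 0 < (C.bottom j).weight i} : ℝ) / #H ≤ 1 / 2 := by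
        rw [div_le_iff₀ hHR]; linarith
      nlinarith)
    (fun j i => by
      by_cases hij : 0 < (C.bottom j).weight i
      · left
        rw [signalStrength, if_pos hij]
        split_ifs
        · refine mul_nonneg hu0.le (sub_nonneg.2 ?_)
          rw [div_le_one hHR]
          exact_mod_cast Finset.card_filter_le _ _
        · exact le_rfl
      · right
        intro x
        have : (C.bottom j).eval (flipBit i x) = (C.bottom j).eval x := by
          refine (C.bottom j).eval_congr fun l hl => flipBit_apply_of_ne (fun h => hij ?_) x
          rwa [h] at hl
        simp only [gateValue, this])
  set p : Fin n → ℝ := fun i => 1 / 2 + bias (signalStrength C H u) ε i with hp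
  have hmean : ∑ i ∈ H, p i = #H / 2 := by
    have : ∑ i ∈ H, bias (signalStrength C H u) ε i = 0 := by
      unfold bias
      rw [Finset.sum_comm]
      refine Finset.sum_eq_zero fun j _ => ?_
      rw [← Finset.mul_sum, sum_signalStrength C hH0, mul_zero]
    rw [hp, Finset.sum_add_distrib, this, Finset.sum_const, nsmul_eq_mul]
    ring
  have hmain := layer_le_sum_influence (p := p) (q := n / 8) hk hC
    (fun i => by
      have := abs_le.1 (hε i)
      constructor <;> simp only [hp] <;> linarith) hcompl
    (fun i hi => by simp [hp, bias, signalStrength, hi]) hmean hH0 hHr (by omega)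
  have hN : (C.numGates : ℝ) ≤ k := by exact_mod_cast numGates_le hk
  rw [Fintype.card_fin] at hle
  have hle' : ∑ j, ∑ i ∈ H with 0 < (C.bottom j).weight i,
      influence p (gateValue (C.bottom j)) i ≤ 16 * k * √(D * L) := by
    refine hle.trans ?_
    rw [hu]
    have : 2 * (C.numGates : ℝ) / (1 / (4 * √(D * L)) / 2) =
        16 * C.numGates * √(D * L) := by field_simp; ring
    rw [this]
    gcongr
  have hq0 : 0 < √(2 * ((n / 8 : ℕ) : ℝ) + 1) := Real.sqrt_pos.2 (by positivity)
  have hr0 : (0 : ℝ) < r := by exact_mod_cast (by omega : 0 < r)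
  have hrs : 0 < √(r : ℝ) := Real.sqrt_pos.2 hr0
  have h1 := hmain.trans (mul_le_mul_of_nonneg_left hle' (by positivity))
  have h2 : #H * √(2 * ((n / 8 : ℕ) : ℝ) + 1) ≤ 512 * k * √(D * L) * √r := by
    rw [mul_one_div, one_div_mul_eq_div, div_le_div_iff₀ (by positivity) hq0] at h1
    linarith
  have h3 := pow_le_pow_left₀ (by positivity) h2 2
  rw [mul_pow, mul_pow, mul_pow, mul_pow, Real.sq_sqrt (by positivity),
    Real.sq_sqrt (by positivity), Real.sq_sqrt (by positivity), hD] at h3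
  have hHn : (n : ℝ) ≤ 65 * #H := by exact_mod_cast (by omega : n ≤ 65 * #H)
  have hqn : (n : ℝ) ≤ 5 * (2 * ((n / 8 : ℕ) : ℝ) + 1) := by
    exact_mod_cast (by omega : n ≤ 5 * (2 * (n / 8) + 1))
  have hrn : 2 * (r : ℝ) ≤ n := by exact_mod_cast (by omega : 2 * r ≤ n)
  have h4 : ((n : ℝ) / 65) ^ 2 * (n / 5) ≤ (#H : ℝ) ^ 2 * (2 * ((n / 8 : ℕ) : ℝ) + 1) :=
    mul_le_mul (pow_le_pow_left₀ (by positivity) (by linarith) 2) (by linarith)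
      (by positivity) (by positivity)
  have h5 : 512 ^ 2 * (k : ℝ) ^ 2 * (4 * k ^ 2 / n * L) * r ≤ 512 ^ 2 * 2 * k ^ 4 * L := by
    have e : 512 ^ 2 * (k : ℝ) ^ 2 * (4 * k ^ 2 / n * L) * r =
      (512 ^ 2 * 2 * k ^ 4 * L) * ((2 * r) / n) := by field_simp; ring
    rw [e]
    refine mul_le_of_le_one_right (by positivity) ?_
    rwa [div_le_one (by linarith)]
  have h6 := (h4.trans h3).trans h5
  have h7 : 0 ≤ (k : ℝ) ^ 4 * L := by positivity
  have h8 : ((n : ℝ) / 65) ^ 2 * (n / 5) = n ^ 3 / 21125 := by ring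
  rw [h8, div_le_iff₀ (by norm_num)] at h6
  linarith

end Circuits

/-! ### Comparison of exponents -/

section Exponents

/-- The bound with exponents `7 / 10` and `1 / 5` is the weaker one, since `log n ≤ n`. -/
lemma rpow_seven_tenths_le {n : ℕ} (hn : 2 ≤ n) :
    (n : ℝ) ^ (7 / 10 : ℝ) * Real.log n ^ (-(1 / 5) : ℝ) ≤
      (n : ℝ) ^ (3 / 4 : ℝ) * Real.log n ^ (-(1 / 4) : ℝ) := by
  have hn' : (2 : ℝ) ≤ n := by exact_mod_cast hn
  have hn0 : (0 : ℝ) < n := by linarith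
  have hl : 0 < Real.log n := Real.log_pos (by linarith)
  have hln : Real.log n ≤ n := Real.log_le_self hn0.le
  have e1 : (n : ℝ) ^ (3 / 4 : ℝ) = (n : ℝ) ^ (7 / 10 : ℝ) * (n : ℝ) ^ (1 / 20 : ℝ) := by
    rw [← Real.rpow_add hn0]; norm_num
  have e2 : Real.log n ^ (-(1 / 5) : ℝ) =
      Real.log n ^ (-(1 / 4) : ℝ) * Real.log n ^ (1 / 20 : ℝ) := by
    rw [← Real.rpow_add hl]; norm_num
  rw [e1, e2]
  have h := Real.rpow_le_rpow hl.le hln (by norm_num : (0 : ℝ) ≤ 1 / 20)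
  have : 0 < (n : ℝ) ^ (7 / 10 : ℝ) * Real.log n ^ (-(1 / 4) : ℝ) := by positivity
  nlinarith [mul_le_mul_of_nonneg_left h this.le]

lemma rpow_three_quarters_pow_four {n : ℕ} (hn : 2 ≤ n) :
    ((n : ℝ) ^ (3 / 4 : ℝ) * Real.log n ^ (-(1 / 4) : ℝ)) ^ 4 = n ^ 3 / Real.log n := by
  have hn' : (2 : ℝ) ≤ n := by exact_mod_cast hn
  have hl : 0 < Real.log n := Real.log_pos (by linarith)
  have e1 : ((n : ℝ) ^ (3 / 4 : ℝ)) ^ 4 = n ^ 3 := by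
    rw [← Real.rpow_natCast, ← Real.rpow_mul (by linarith), ← Real.rpow_natCast (n : ℝ) 3]
    norm_num
  have e2 : (Real.log n ^ (-(1 / 4) : ℝ)) ^ 4 = (Real.log n)⁻¹ := by
    rw [← Real.rpow_natCast, ← Real.rpow_mul hl.le, ← Real.rpow_neg_one]
    norm_num
  rw [mul_pow, e1, e2, div_eq_mul_inv]

end Exponents

theorem mainTheorem2 :
    ∃ c : ℝ, 0 < c ∧
      ∀ (n k W : ℕ) (C : DepthTwoCircuit n), 2 ≤ n →
        C.IsMajMaj k → C.VarWeightsLE W → (∀ x : Fin n → Bool, C.eval x = majority n x) →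
          c * (n : ℝ) ^ (7 / 10 : ℝ) * Real.log n ^ (-(1 / 5) : ℝ) * (W : ℝ) ^ (-(3 / 10) : ℝ)
            ≤ (k : ℝ) := by
  refine ⟨1 / 10 ^ 5, by norm_num, fun n k W C hn hk _ hC => ?_⟩
  have hk1 : (1 : ℝ) ≤ k := by exact_mod_cast one_le_of_computes hn hk hC
  have hn' : (2 : ℝ) ≤ n := by exact_mod_cast hn
  have hlog2 : 1 / 2 ≤ Real.log n :=
    (by linarith [Real.log_two_gt_d9] : 1 / 2 ≤ Real.log 2).trans
      (Real.log_le_log (by norm_num) hn')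
  have hl : 0 < Real.log n := by linarith
  set Y := (n : ℝ) ^ (3 / 4 : ℝ) * Real.log n ^ (-(1 / 4) : ℝ) with hY
  have hXY := rpow_seven_tenths_le hn
  have hY4 := rpow_three_quarters_pow_four hn
  have hX0 : 0 ≤ (n : ℝ) ^ (7 / 10 : ℝ) * Real.log n ^ (-(1 / 5) : ℝ) := by positivity
  -- for `W = 0` the power is `0` by the convention for `Real.rpow`
  have hW : (W : ℝ) ^ (-(3 / 10) : ℝ) ≤ 1 := by
    rcases Nat.eq_zero_or_pos W with h | h
    · rw [h, Nat.cast_zero, Real.zero_rpow (by norm_num)]; norm_num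
    · exact Real.rpow_le_one_of_one_le_of_nonpos (by exact_mod_cast h) (by norm_num)
  have key : Y ≤ 10 ^ 5 * k := by
    refine le_of_pow_le_pow_left₀ (n := 4) (by norm_num) (by positivity) ?_
    rw [hY4, div_le_iff₀ hl]
    have hk4 : (1 : ℝ) ≤ (k : ℝ) ^ 4 := one_le_pow₀ hk1
    rcases lt_or_ge n 10000 with h | h
    · have h1 : (n : ℝ) ≤ 10 ^ 4 := by exact_mod_cast h.le
      have h2 : (n : ℝ) ^ 3 ≤ (10 ^ 4) ^ 3 := pow_le_pow_left₀ (by positivity) h1 3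
      nlinarith [mul_le_mul hk4 hlog2 (by norm_num) (by positivity)]
    · rcases lt_or_ge n (200 * k) with h' | h'
      · have h1 : (n : ℝ) ≤ 200 * k := by exact_mod_cast h'.le
        have h2 : (n : ℝ) ^ 3 ≤ (200 * k) ^ 3 := pow_le_pow_left₀ (by positivity) h1 3
        have h3 : (k : ℝ) ^ 3 ≤ k ^ 4 := pow_le_pow_right₀ hk1 (by norm_num)
        nlinarith [mul_le_mul_of_nonneg_left hlog2 (by positivity : 0 ≤ (k : ℝ) ^ 4)]
      · have h1 := pow_three_le_mul_log h h' hk hC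
        have h2 : Real.log (4 * n) ≤ 3 * Real.log n := by
          have e : Real.log ((n : ℝ) ^ 3) = 3 * Real.log n := by
            rw [Real.log_pow]; norm_num
          rw [← e]
          have : (4 : ℝ) ≤ (n : ℝ) ^ 2 := by nlinarith
          exact Real.log_le_log (by positivity) (by nlinarith)
        have h3 : 0 ≤ (k : ℝ) ^ 4 := by positivity
        nlinarith [mul_le_mul_of_nonneg_left h2 h3, mul_nonneg h3 hl.le]
  calc 1 / 10 ^ 5 * (n : ℝ) ^ (7 / 10 : ℝ) * Real.log n ^ (-(1 / 5) : ℝ) *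
        (W : ℝ) ^ (-(3 / 10) : ℝ)
      = 1 / 10 ^ 5 * ((n : ℝ) ^ (7 / 10 : ℝ) * Real.log n ^ (-(1 / 5) : ℝ) *
        (W : ℝ) ^ (-(3 / 10) : ℝ)) := by ring
    _ ≤ 1 / 10 ^ 5 * ((n : ℝ) ^ (7 / 10 : ℝ) * Real.log n ^ (-(1 / 5) : ℝ)) := by
        exact mul_le_mul_of_nonneg_left (mul_le_of_le_one_right hX0 hW) (by norm_num)
    _ ≤ k := by linarith
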